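/- Let $L=(l_1,\dots,l_k)$ be a vector of positive integers with $l_1+\dots+l_k=n$ that is generic ($\sum_{i\in I}l_i=\sum_{j\in J}l_j$ implies $I=J$ for all $I,J\subseteq[k]$) and reduced ($\gcd(l_1,\dots,l_k)=1$). The generalized Tonnetz $T=Tonn^{n,k}(L)$ is the simplicial complex on $\mathbb Z_n$ whose maximal simplices are the sets $\{x,\;x+l_{\sigma(1)},\;\dots,\;x+l_{\sigma(1)}+\dots+l_{\sigma(k-1)}\}$ for $x\in\mathbb Z_n$ and $\sigma\in S_k$. The $L$-type of an oriented edge $\overrightarrow{uv}$ of $T$ is the unique non-empty $I\subseteq[k]$ with $v-u=\sum_{i\in I}l_i$ in $\mathbb Z_n$. For $i\ne j$ let $\theta_{i,j}$ be the simplicial $1$-cocycle on $T$ whose value on an oriented edge of type $I$ is $|I\cap\{i\}|-|I\cap\{j\}|$, and let $\omega_i=\sum_{j\neq i}\theta_{i,j}$ and $\omega=(\omega_1,\dots,\omega_k)$. The cocycle $\omega$ takes values in the permutohedral lattice $$\Lambda=\{x\in\mathbb Z^k \mid \textstyle\sum_i x_i=0,\ \text{all } x_i \text{ congruent modulo } k\},$$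 and induces a homomorphism $\widehat\omega:H_1(T;\mathbb Z)\to\Lambda$. Put $\Lambda_L:=\widehat\omega(H_1(T;\mathbb Z))$. Let $a_i\in\Lambda$ be the vector with $i$-th coordinate $k-1$ and all other coordinates $-1$; for $k\ge 2$ it is $a_i=\omega(E_i)$, the value of $\omega$ on every edge $E_i=\overrightarrow{x\,(x+l_i)}$, $x\in\mathbb Z_n$. Then $$\Lambda_L=\Big\{\sum_{i=1}^k p_ia_i \;\Big|\; p_1,\dots,p_k\in\mathbb Z \text{ and } \sum_{i=1}^k p_il_i=p_0n \text{ for some } p_0\in\mathbb Z\Big\}.$$ Moreover, $\Lambda_L$ is the lattice that appears in the isomorphism $Tonn^{n,k}(L)\cong\mathcal D_\Lambda/\Lambda_L$ induced by $\omega$, where $\mathcal D_\Lambda$ is the Delone triangulation of the hyperplane $\{x\in\mathbb R^k\mid \sum_i x_i=0\}$ associated with $\Lambda$. That is: no two vertices of a simplex of $\mathcal D_\Lambda$ are in the same $\Lambda_L$-orbit, and two simplices of $\mathcal D_\Lambda$ with the same image in $\Lambda/\Lambda_L$ differ by a translation from $\Lambda_L$; and for every base vertex $v_0\in\mathbb Z_n$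 there is an isomorphism of simplicial complexes $\Phi:Tonn^{n,k}(L)\to\mathcal D_\Lambda/\Lambda_L$ with $\Phi(v_0)=0$ and $\Phi(v)=\Phi(u)+[\omega(\overrightarrow{uv})]$ for every oriented edge $\overrightarrow{uv}$. -/

import Mathlib

namespace GenTonnetz

/-! ### First simplicial homology of an abstract simplicial complex -/

section Homology

variable {V : Type*} [DecidableEq V] (K : PreAbstractSimplicialComplex V)

/-- `(u, v)` are the distinct end-points of an edge of `K`. -/
def IsEdge (u v : V) : Prop := u ≠ v ∧ ({u, v} : Finset V) ∈ K.faces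

variable {K} in
theorem IsEdge.symm {u v : V} (h : IsEdge K u v) : IsEdge K v u :=
  ⟨h.1.symm, by rw [Finset.pair_comm]; exact h.2⟩

/-- The oriented 1-simplices of `K`. -/
def OrientedEdge : Type _ := {e : V × V // IsEdge K e.1 e.2}

variable {K} in
/-- The oriented 1-simplex from `u` to `v`. -/
def OrientedEdge.mk (u v : V) (h : IsEdge K u v) : OrientedEdge K := ⟨(u, v), h⟩

variable {K} in
/-- The initial vertex. -/
def OrientedEdge.src (e : OrientedEdge K) : V := e.1.1

variable {K} in
/-- The final vertex. -/
def OrientedEdge.tgt (e : OrientedEdge K) : V := e.1.2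

variable {K} in
/-- The same edge with the opposite orientation. -/
def OrientedEdge.rev (e : OrientedEdge K) : OrientedEdge K := ⟨(e.1.2, e.1.1), e.2.symm⟩

/-- The relations `e + e⁻¹ = 0` between oriented 1-simplices. -/
noncomputable def orientationRel : AddSubgroup (OrientedEdge K →₀ ℤ) :=
  AddSubgroup.closure
    (Set.range fun e : OrientedEdge K => Finsupp.single e 1 + Finsupp.single e.rev 1)

/-- The group `C₁(K; ℤ)` of oriented simplicial 1-chains. -/
abbrev Chain₁ : Type _ := (OrientedEdge K →₀ ℤ) ⧸ orientationRel K

variable {K} in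
/-- The 1-chain given by one oriented 1-simplex. -/
noncomputable def Chain₁.of (e : OrientedEdge K) : Chain₁ K := QuotientAddGroup.mk (Finsupp.single e 1)

variable {K} in
/-- A function on oriented 1-simplices that is odd under reversing the orientation extends uniquely
to a homomorphism on `C₁(K; ℤ)`. -/
noncomputable def Chain₁.lift {M : Type*} [AddCommGroup M] (f : OrientedEdge K → M)
    (hf : ∀ e, f e.rev = -f e) : Chain₁ K →+ M :=
  QuotientAddGroup.lift (orientationRel K)
    (Finsupp.liftAddHom fun e => (zmultiplesHom M) (f e))
    (by
      rw [orientationRel, AddSubgroup.closure_le]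
      rintro _ ⟨e, rfl⟩
      simp [hf])

variable {K} in
@[simp] theorem Chain₁.lift_of {M : Type*} [AddCommGroup M] (f : OrientedEdge K → M)
    (hf : ∀ e, f e.rev = -f e) (e : OrientedEdge K) :
    Chain₁.lift f hf (Chain₁.of e) = f e := by
  simp [Chain₁.lift, Chain₁.of]

variable {K} in
theorem Chain₁.induction {p : Chain₁ K → Prop} (c : Chain₁ K)
    (h0 : p 0)
    (hof : ∀ e, p (Chain₁.of e)) (hadd : ∀ a b, p a → p b → p (a + b))
    (hneg : ∀ a, p a → p (-a)) : p c := by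
  obtain ⟨c, rfl⟩ := QuotientAddGroup.mk_surjective c
  induction c using Finsupp.induction_linear with
  | zero => exact h0
  | add f g hf hg => exact hadd _ _ hf hg
  | single e m =>
    have key : ∀ m : ℤ, (QuotientAddGroup.mk (Finsupp.single e m) : Chain₁ K)
        = m • Chain₁.of e := by
      intro m
      rw [Chain₁.of, ← QuotientAddGroup.mk_zsmul, Finsupp.smul_single, smul_eq_mul, mul_one]
    rw [key]
    induction m using Int.induction_on with
    | zero => simpa using h0
    | succ i ih => rw [add_zsmul, one_zsmul]; exact hadd _ _ ih (hof e)
    | pred i ih =>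
      rw [sub_zsmul, one_zsmul]; exact hadd _ _ ih (hneg _ (hof e))

/-- The boundary operator on 1-chains, `∂(uv) = v - u`. -/
noncomputable def boundary₁ : Chain₁ K →+ (V →₀ ℤ) :=
  Chain₁.lift (fun e => Finsupp.single e.tgt 1 - Finsupp.single e.src 1)
    (fun e => by simp [OrientedEdge.rev, OrientedEdge.src, OrientedEdge.tgt])

/-- The group `Z₁` of simplicial 1-cycles. -/
noncomputable def cycles₁ : AddSubgroup (Chain₁ K) := (boundary₁ K).ker

/-- The group `B₁` of 1-boundaries: it is generated by the boundaries `uv + vw + wu` of the oriented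
2-simplices of `K`. -/
noncomputable def boundaries₁ : AddSubgroup (Chain₁ K) :=
  AddSubgroup.closure {c | ∃ (u v w : V) (huv : IsEdge K u v) (hvw : IsEdge K v w)
    (hwu : IsEdge K w u), ({u, v, w} : Finset V) ∈ K.faces ∧
    c = Chain₁.of (.mk u v huv) + Chain₁.of (.mk v w hvw) + Chain₁.of (.mk w u hwu)}

/-- The first simplicial homology group `H₁(K; ℤ) = Z₁ / B₁`. -/
abbrev H₁ : Type _ := cycles₁ K ⧸ (boundaries₁ K).addSubgroupOf (cycles₁ K)

end Homology

/-- A bijection of vertices that is an isomorphism of simplicial complexes. -/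
def IsSimplicialIso {V W : Type*} (K : PreAbstractSimplicialComplex V)
    (K' : PreAbstractSimplicialComplex W) (Φ : V ≃ W) : Prop :=
  ∀ s : Finset V, s ∈ K.faces ↔ s.map Φ.toEmbedding ∈ K'.faces

/-! ### The generalized Tonnetz -/

section Complex

variable {k : ℕ} (n : ℕ) (L : Fin k → ℕ)

/-- `L = (l₁, …, l_k)` is a vector of positive integers with sum `n`. -/
structure IsLengthVector : Prop where
  pos : ∀ i, 0 < L i
  sum_eq : ∑ i, L i = n

/-- Sums over different sets of indices are different. -/
def IsGeneric : Prop :=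
  ∀ I J : Finset (Fin k), ∑ i ∈ I, L i = ∑ j ∈ J, L j → I = J

/-- The greatest common divisor of all the `l_i` is `1`. -/
def IsReduced : Prop := Finset.univ.gcd L = 1

/-- The set `{x, x + l_{σ(1)}, …, x + l_{σ(1)} + ⋯ + l_{σ(k-1)}}` in `ℤ/n`. -/
def maxSimplex (x : ZMod n) (σ : Equiv.Perm (Fin k)) : Finset (ZMod n) :=
  Finset.univ.image fun j : Fin k => x + ∑ i ∈ Finset.Iio j, (L (σ i) : ZMod n)

/-- The generalized Tonnetz `Tonn^{n,k}(L)`. -/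
def tonnetz : PreAbstractSimplicialComplex (ZMod n) where
  faces := {s | s.Nonempty ∧ ∃ x σ, s ⊆ maxSimplex n L x σ}
  isRelLowerSet_faces := by
    rintro s ⟨hs, x, σ, h⟩
    exact ⟨hs, fun t hts ht => ⟨ht, x, σ, hts.trans h⟩⟩

variable {n L}

/-- An auxiliary set of indices: the `L`-type of an edge joining two vertices of a simplex that are
reached from a common vertex by steps with index sets `P` and `Q`. -/
def typeBetween (P Q : Finset (Fin k)) : Finset (Fin k) := if P ⊆ Q then Q \ P else (P \ Q)ᶜ

theorem sum_typeBetween {M : Type*} [AddCommGroup M] (f : Fin k → M) (hf : ∑ i, f i = 0)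
    {P Q : Finset (Fin k)} (h : P ⊆ Q ∨ Q ⊆ P) :
    ∑ i ∈ typeBetween P Q, f i = ∑ i ∈ Q, f i - ∑ i ∈ P, f i := by
  unfold typeBetween
  split_ifs with hPQ
  · rw [Finset.sum_sdiff_eq_sub hPQ]
  · have hQP := h.resolve_left hPQ
    have h1 := Finset.sum_compl_add_sum (P \ Q) f
    rw [hf, Finset.sum_sdiff_eq_sub hQP] at h1
    rw [eq_neg_of_add_eq_zero_left h1]; abel

theorem IsLengthVector.sum_cast (hL : IsLengthVector n L) :
    ∑ i, (L i : ZMod n) = 0 := by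
  rw [← Nat.cast_sum, hL.sum_eq, ZMod.natCast_self]

theorem exists_index_sets {s : Finset (ZMod n)} (hs : s ∈ (tonnetz n L).faces) :
    ∃ (x : ZMod n) (P : ZMod n → Finset (Fin k)),
      (∀ v ∈ s, v = x + ∑ i ∈ P v, (L i : ZMod n)) ∧
      ∀ u ∈ s, ∀ v ∈ s, P u ⊆ P v ∨ P v ⊆ P u := by
  obtain ⟨⟨v₁, hv₁⟩, x, σ, h⟩ := hs
  have h' : ∀ v ∈ s, ∃ j : Fin k, x + ∑ i ∈ Finset.Iio j, (L (σ i) : ZMod n) = v := by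
    intro v hv
    simpa [maxSimplex] using h hv
  classical
  have : Nonempty (Fin k) := ⟨(h' v₁ hv₁).choose⟩
  choose! j hj using h'
  refine ⟨x, fun v => (Finset.Iio (j v)).map σ.toEmbedding, fun v hv => ?_, fun u _ v _ => ?_⟩
  · rw [Finset.sum_map]; exact (hj v hv).symm
  · rcases le_total (j u) (j v) with h1 | h1
    · exact Or.inl (Finset.map_subset_map.2 (Finset.Iio_subset_Iio h1))
    · exact Or.inr (Finset.map_subset_map.2 (Finset.Iio_subset_Iio h1))

theorem exists_edgeType (hL : IsLengthVector n L) (e : OrientedEdge (tonnetz n L)) :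
    ∃ I : Finset (Fin k), I.Nonempty ∧ e.tgt - e.src = ∑ i ∈ I, (L i : ZMod n) := by
  obtain ⟨x, P, hP, hc⟩ := exists_index_sets e.2.2
  have hu : e.src ∈ ({e.1.1, e.1.2} : Finset (ZMod n)) := by simp [OrientedEdge.src]
  have hv : e.tgt ∈ ({e.1.1, e.1.2} : Finset (ZMod n)) := by simp [OrientedEdge.tgt]
  have hsum : e.tgt - e.src = ∑ i ∈ typeBetween (P e.src) (P e.tgt), (L i : ZMod n) := by
    rw [sum_typeBetween _ hL.sum_cast (hc _ hu _ hv)]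
    conv_lhs => rw [hP _ hu, hP _ hv]
    ring
  refine ⟨_, ?_, hsum⟩
  rw [Finset.nonempty_iff_ne_empty]
  intro h0
  rw [h0, Finset.sum_empty, sub_eq_zero] at hsum
  exact e.2.1 hsum.symm

/-- The `L`-type of an oriented 1-simplex `uv`: the non-empty set `I` of indices for which the
length `v - u` of the interval from `u` to `v` is `∑ i ∈ I, l_i`. For generic `L` it is unique, see
`edgeType_eq`. -/
noncomputable def edgeType (hL : IsLengthVector n L) (e : OrientedEdge (tonnetz n L)) :
    Finset (Fin k) := (exists_edgeType hL e).choose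

theorem edgeType_eq (hL : IsLengthVector n L) (hg : IsGeneric L) (e : OrientedEdge (tonnetz n L))
    (I : Finset (Fin k)) (hI : e.tgt - e.src = ∑ i ∈ I, (L i : ZMod n)) : edgeType hL e = I := by
  have key : ∀ J : Finset (Fin k), e.tgt - e.src = ∑ i ∈ J, (L i : ZMod n) →
      ∑ i ∈ J, L i < n := by
    intro J hJ
    refine lt_of_le_of_ne ?_ ?_
    · rw [← hL.sum_eq]
      exact Finset.sum_le_sum_of_subset (Finset.subset_univ J)
    · intro h
      rw [← Nat.cast_sum, h, ZMod.natCast_self, sub_eq_zero] at hJ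
      exact e.2.1 hJ.symm
  have hE := (exists_edgeType hL e).choose_spec.2
  apply hg
  have h1 := key _ hE
  have h2 := key _ hI
  rw [hE, ← Nat.cast_sum, ← Nat.cast_sum, ZMod.natCast_eq_natCast_iff'] at hI
  rwa [Nat.mod_eq_of_lt h1, Nat.mod_eq_of_lt h2] at hI

/-! ### The canonical cocycles -/

/-- The value of the elementary cocycle `θ_{i,j}` (`i ≠ j`) on a positively oriented atomic
1-simplex of type `m`: it is `1` for `m = i`, `-1` for `m = j` and `0` otherwise. -/
def thetaAtom (i j m : Fin k) : ℤ := (if m = i then 1 else 0) - (if m = j then 1 else 0)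

theorem sum_thetaAtom (i j : Fin k) : ∑ m, thetaAtom i j m = 0 := by
  simp [thetaAtom]

/-- The value of `θ_{i,j}` on an oriented 1-simplex: the sum over the atoms into which the simplex
decomposes. -/
noncomputable def thetaEdge (hL : IsLengthVector n L) (i j : Fin k)
    (e : OrientedEdge (tonnetz n L)) : ℤ := ∑ m ∈ edgeType hL e, thetaAtom i j m

theorem exists_potential (hL : IsLengthVector n L) (hg : IsGeneric L) (i j : Fin k)
    {s : Finset (ZMod n)} (hs : s ∈ (tonnetz n L).faces) :
    ∃ F : ZMod n → ℤ, ∀ e : OrientedEdge (tonnetz n L), e.src ∈ s → e.tgt ∈ s →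
      thetaEdge hL i j e = F e.tgt - F e.src := by
  obtain ⟨x, P, hP, hc⟩ := exists_index_sets hs
  refine ⟨fun v => ∑ m ∈ P v, thetaAtom i j m, fun e hu hv => ?_⟩
  have h1 : edgeType hL e = typeBetween (P e.src) (P e.tgt) := by
    apply edgeType_eq hL hg
    rw [sum_typeBetween _ hL.sum_cast (hc _ hu _ hv)]
    conv_lhs => rw [hP _ hu, hP _ hv]
    ring
  rw [thetaEdge, h1, sum_typeBetween _ (sum_thetaAtom i j) (hc _ hu _ hv)]

theorem thetaEdge_rev (hL : IsLengthVector n L) (hg : IsGeneric L) (i j : Fin k)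
    (e : OrientedEdge (tonnetz n L)) : thetaEdge hL i j e.rev = -thetaEdge hL i j e := by
  obtain ⟨F, hF⟩ := exists_potential hL hg i j e.2.2
  rw [hF e (by simp [OrientedEdge.src]) (by simp [OrientedEdge.tgt]),
    hF e.rev (by simp [OrientedEdge.src, OrientedEdge.rev])
      (by simp [OrientedEdge.tgt, OrientedEdge.rev])]
  simp [OrientedEdge.src, OrientedEdge.tgt, OrientedEdge.rev]

/-- The elementary cocycle `θ_{i,j}`. -/
noncomputable def theta (hL : IsLengthVector n L) (hg : IsGeneric L) (i j : Fin k) :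
    Chain₁ (tonnetz n L) →+ ℤ :=
  Chain₁.lift (thetaEdge hL i j) (thetaEdge_rev hL hg i j)

theorem theta_boundaries (hL : IsLengthVector n L) (hg : IsGeneric L) (i j : Fin k) :
    boundaries₁ (tonnetz n L) ≤ (theta hL hg i j).ker := by
  rw [boundaries₁, AddSubgroup.closure_le]
  rintro _ ⟨u, v, w, huv, hvw, hwu, hs, rfl⟩
  obtain ⟨F, hF⟩ := exists_potential hL hg i j hs
  simp only [SetLike.mem_coe, AddMonoidHom.mem_ker, map_add, theta, Chain₁.lift_of]
  rw [hF (.mk u v huv) (by simp [OrientedEdge.src, OrientedEdge.mk])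
      (by simp [OrientedEdge.tgt, OrientedEdge.mk]),
    hF (.mk v w hvw) (by simp [OrientedEdge.src, OrientedEdge.mk])
      (by simp [OrientedEdge.tgt, OrientedEdge.mk]),
    hF (.mk w u hwu) (by simp [OrientedEdge.src, OrientedEdge.mk])
      (by simp [OrientedEdge.tgt, OrientedEdge.mk])]
  simp only [OrientedEdge.src, OrientedEdge.tgt, OrientedEdge.mk]
  ring

/-- The canonical cocycle `ω_i = ∑_{j ≠ i} θ_{i,j}`. -/
noncomputable def omegaCoord (hL : IsLengthVector n L) (hg : IsGeneric L) (i : Fin k) :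
    Chain₁ (tonnetz n L) →+ ℤ := ∑ j ∈ Finset.univ.erase i, theta hL hg i j

variable (k) in
/-- The permutohedral lattice `Λ`: integer vectors with coordinate sum `0` all of whose coordinates
are in the same congruence class modulo `k`. -/
def permLattice : AddSubgroup (Fin k → ℤ) where
  carrier := {x | ∑ i, x i = 0 ∧ ∀ i j, x i ≡ x j [ZMOD k]}
  zero_mem' := ⟨by simp, fun _ _ => rfl⟩
  add_mem' := fun {x y} hx hy =>
    ⟨by simp [Finset.sum_add_distrib, hx.1, hy.1], fun i j => (hx.2 i j).add (hy.2 i j)⟩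
  neg_mem' := fun {x} hx => ⟨by simp [hx.1], fun i j => (hx.2 i j).neg⟩

theorem omegaCoord_of (hL : IsLengthVector n L) (hg : IsGeneric L) (i : Fin k)
    (e : OrientedEdge (tonnetz n L)) :
    omegaCoord hL hg i (Chain₁.of e) =
      (k : ℤ) * (if i ∈ edgeType hL e then 1 else 0) - (edgeType hL e).card := by
  have h : ∀ j, theta hL hg i j (Chain₁.of e) =
      (if i ∈ edgeType hL e then 1 else 0) - (if j ∈ edgeType hL e then 1 else 0) := by
    intro j
    simp [theta, thetaEdge, thetaAtom, Finset.sum_sub_distrib]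
  rw [omegaCoord, AddMonoidHom.finsetSum_apply, Finset.sum_erase _ (by rw [h]; ring)]
  simp only [h, Finset.sum_sub_distrib]
  simp

theorem omega_mem (hL : IsLengthVector n L) (hg : IsGeneric L) (c : Chain₁ (tonnetz n L)) :
    (fun i => omegaCoord hL hg i c) ∈ permLattice k := by
  induction c using Chain₁.induction with
  | h0 => simp only [map_zero]; exact (permLattice k).zero_mem
  | hadd a b ha hb => simp only [map_add]; exact (permLattice k).add_mem ha hb
  | hneg a ha => simp only [map_neg]; exact (permLattice k).neg_mem ha
  | hof e =>
    refine ⟨?_, fun i j => ?_⟩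
    · simp only [omegaCoord_of, Finset.sum_sub_distrib, ← Finset.mul_sum]
      simp
    · simp only [omegaCoord_of]
      refine Int.ModEq.sub ?_ rfl
      exact ((Int.modEq_zero_iff_dvd.2 (dvd_mul_right _ _))).trans
        (Int.modEq_zero_iff_dvd.2 (dvd_mul_right _ _)).symm

/-- The vector valued cocycle `ω = (ω_1, …, ω_k)`, with values in the lattice `Λ`. -/
noncomputable def omega (hL : IsLengthVector n L) (hg : IsGeneric L) :
    Chain₁ (tonnetz n L) →+ permLattice k where
  toFun c := ⟨fun i => omegaCoord hL hg i c, omega_mem hL hg c⟩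
  map_zero' := by ext i; simp
  map_add' := fun a b => by ext i; simp

theorem omega_boundaries (hL : IsLengthVector n L) (hg : IsGeneric L) :
    boundaries₁ (tonnetz n L) ≤ (omega hL hg).ker := by
  intro c hc
  rw [AddMonoidHom.mem_ker]
  ext i
  change omegaCoord hL hg i c = 0
  rw [omegaCoord, AddMonoidHom.finsetSum_apply]
  exact Finset.sum_eq_zero fun j _ => theta_boundaries hL hg i j hc

/-- The homomorphism `ω̂ : H₁(Tonn^{n,k}(L); ℤ) → Λ` induced by the cocycle `ω`. -/
noncomputable def omegaHat (hL : IsLengthVector n L) (hg : IsGeneric L) :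
    H₁ (tonnetz n L) →+ permLattice k :=
  QuotientAddGroup.lift _ ((omega hL hg).comp (cycles₁ (tonnetz n L)).subtype)
    (fun _ hc => omega_boundaries hL hg (AddSubgroup.mem_addSubgroupOf.1 hc))

/-- The lattice `Λ_L = ω̂(H₁(Tonn^{n,k}(L); ℤ)) ⊆ Λ`. -/
noncomputable def periodLattice (hL : IsLengthVector n L) (hg : IsGeneric L) :
    AddSubgroup (permLattice k) := (omegaHat hL hg).range

/-- The vector `a_i ∈ Λ` with `i`-th coordinate `k - 1` and all other coordinates `-1`. -/
def stepVector (i : Fin k) : permLattice k :=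
  ⟨fun j => if j = i then (k : ℤ) - 1 else -1, by
    have h : ∀ j : Fin k, (if j = i then (k : ℤ) - 1 else -1) = (if j = i then (k : ℤ) else 0) - 1 := by
      intro j; split_ifs <;> ring
    refine ⟨?_, fun j m => ?_⟩
    · simp [h]
    · simp only [h]
      refine Int.ModEq.sub ?_ rfl
      have h0 : ∀ j : Fin k, (if j = i then (k : ℤ) else 0) ≡ 0 [ZMOD k] := by
        intro j; split_ifs <;> simp [Int.ModEq]
      exact (h0 j).trans (h0 m).symm⟩

/-! ### The Delone triangulation of the permutohedral lattice -/

/-- A lattice vector as a point of Euclidean space `ℝ^k`. -/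
noncomputable def toEuclidean (z : permLattice k) : EuclideanSpace ℝ (Fin k) :=
  WithLp.toLp 2 fun i => ((z : Fin k → ℤ) i : ℝ)

variable (k) in
/-- The Delone complex `𝒟_Λ` of the lattice `Λ` in the hyperplane `H₀ = {c | ∑ c_i = 0}`: a
non-empty finite set `s` of lattice points is a simplex if and only if it lies on an empty sphere,
that is, if and only if there is a centre `c ∈ H₀` such that no lattice point is closer to `c` than
any of the points of `s`. -/
noncomputable def deloneComplex : PreAbstractSimplicialComplex (permLattice k) where
  faces := {s | s.Nonempty ∧ ∃ c : EuclideanSpace ℝ (Fin k), ∑ i, c i = 0 ∧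
    ∀ z ∈ s, ∀ y : permLattice k, dist c (toEuclidean z) ≤ dist c (toEuclidean y)}
  isRelLowerSet_faces := by
    rintro s ⟨hs, c, hc, h⟩
    exact ⟨hs, fun t hts ht => ⟨ht, c, hc, fun z hz => h z (hts hz)⟩⟩

open Classical in
/-- The quotient complex `𝒟_Λ / Γ` by a group `Γ` of lattice translations: its vertices are the
`Γ`-orbits of lattice points, its simplices the images of the simplices of `𝒟_Λ`. -/
noncomputable def deloneQuotient (Γ : AddSubgroup (permLattice k)) :
    PreAbstractSimplicialComplex (permLattice k ⧸ Γ) :=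
  (deloneComplex k).map (QuotientAddGroup.mk : permLattice k → permLattice k ⧸ Γ)

/-- `Γ` acts on `𝒟_Λ` so that `𝒟_Λ / Γ` is a quotient in the category of simplicial complexes: no
two vertices of a simplex are in the same orbit, and simplices with the same image in the quotient
are translates of each other by an element of `Γ`. -/
def ActsRegularly (Γ : AddSubgroup (permLattice k)) : Prop :=
  (∀ s ∈ (deloneComplex k).faces,
    Set.InjOn (QuotientAddGroup.mk : permLattice k → permLattice k ⧸ Γ) s) ∧
  ∀ s ∈ (deloneComplex k).faces, ∀ t ∈ (deloneComplex k).faces,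
    (QuotientAddGroup.mk : permLattice k → permLattice k ⧸ Γ) '' s = QuotientAddGroup.mk '' t →
    ∃ g ∈ Γ, (t : Set (permLattice k)) = (fun z => g + z) '' s

end Complex

end GenTonnetz

/-! Everything is governed by one homomorphism `φ : Λ → ℤ/n` with `φ(a_i) = l_i`. It exists because
the `a_i` generate `Λ`, their only relations are the multiples of `∑ a_i = 0`, and `∑ l_i = n`
vanishes in `ℤ/n`. It is onto because the `l_i` have gcd 1.

For an edge `e` from `u` to `v` one has `φ(ω(e)) = v - u`, so `φ ∘ ω` only depends on the boundary
and kills cycles. Conversely every `z ∈ Λ` is the value of `ω` on a path from `0` to `φ(z)`, which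
is closed when `φ(z) = 0`. Hence `Λ_L = ker φ` (`periodLattice_eq_ker`), and the explicit
description follows by writing out `φ(∑ p_i a_i) = 0`.

For the isomorphism, both complexes have the same combinatorial form: their simplices are the
non-empty sets of partial sums `x + f_{σ(1)} + ⋯`, with `f = l` for the Tonnetz by definition and `f
= a` for `𝒟_Λ` (`mem_delone_iff`). Homomorphisms preserve such flags, and flags lift along
surjections, so `φ` identifies `𝒟_Λ / ker φ` with the Tonnetz. Genericity enters through the fact
that sums of the `l_i` over different proper index sets remain different modulo `n`; this makes the
action regular. -/

namespace GenTonnetz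

/-! ### Flags of partial sums in an abelian group -/

section Flags

variable {k : ℕ} {G H : Type*} [AddCommGroup G] [AddCommGroup H]

/-- `s` is contained in `{x, x + f_{σ(1)}, …, x + f_{σ(1)} + ⋯ + f_{σ(k-1)}}` for some `x`, `σ`. -/
def IsFlagFace (f : Fin k → G) (s : Finset G) : Prop :=
  ∃ (x : G) (σ : Equiv.Perm (Fin k)), ∀ v ∈ s, ∃ j : Fin k, v = x + ∑ i ∈ Finset.Iio j, f (σ i)

/-- Sort the indices by the number of members of the chain that miss them. In a chain, an index in
`P v` is missed by strictly fewer members than an index outside `P v`, so each `P v` becomes an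
initial segment. The whole set is excluded because `Finset.Iio j` always omits `j`. -/
theorem exists_perm_of_chain {ι : Type*} (s : Finset ι) (P : ι → Finset (Fin k))
    (hP : ∀ v ∈ s, P v ≠ Finset.univ) (hc : ∀ u ∈ s, ∀ v ∈ s, P u ⊆ P v ∨ P v ⊆ P u) :
    ∃ σ : Equiv.Perm (Fin k), ∀ v ∈ s, ∃ j, P v = (Finset.Iio j).map σ.toEmbedding := by
  classical
  let f : Fin k → ℕ := fun i => (s.filter fun v => i ∉ P v).card
  have hmono := Tuple.monotone_sort f
  set σ := Tuple.sort f
  refine ⟨σ, fun v hv => ?_⟩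
  have hlow : ∀ a b : Fin k, a ≤ b → σ b ∈ P v → σ a ∈ P v := by
    intro a b hab hb
    by_contra ha
    have h1 : f (σ a) ≤ f (σ b) := hmono hab
    refine absurd h1 (not_le.2 (Finset.card_lt_card ?_))
    rw [Finset.ssubset_iff_of_subset]
    · exact ⟨v, by simp [hv, ha], by simp [hb]⟩
    · intro w hw
      simp only [Finset.mem_filter] at hw ⊢
      refine ⟨hw.1, fun h => ?_⟩
      rcases hc w hw.1 v hv with h2 | h2
      · exact ha (h2 h)
      · exact hw.2 (h2 hb)
  have hne : (Finset.univ.filter fun a => σ a ∉ P v).Nonempty := by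
    by_contra h
    rw [Finset.not_nonempty_iff_eq_empty, Finset.filter_eq_empty_iff] at h
    refine hP v hv (Finset.eq_univ_iff_forall.2 fun i => ?_)
    simpa using h (Finset.mem_univ (σ.symm i))
  have hj := Finset.min'_mem _ hne
  set j := (Finset.univ.filter fun a => σ a ∉ P v).min' hne
  refine ⟨j, ?_⟩
  simp only [Finset.mem_filter, Finset.mem_univ, true_and] at hj
  ext i
  obtain ⟨a, rfl⟩ := σ.surjective i
  simp only [Finset.mem_map_equiv, Equiv.symm_apply_apply, Finset.mem_Iio]
  constructor
  · intro h
    by_contra hlt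
    exact hj (hlow j a (not_lt.1 hlt) h)
  · intro h
    by_contra hn
    exact absurd (Finset.min'_le _ a (by simp [hn])) (not_le.2 h)

theorem isFlagFace_of_chain {f : Fin k → G} {s : Finset G} (x : G) (P : G → Finset (Fin k))
    (hP : ∀ v ∈ s, P v ≠ Finset.univ) (hv : ∀ v ∈ s, v = x + ∑ i ∈ P v, f i)
    (hc : ∀ u ∈ s, ∀ v ∈ s, P u ⊆ P v ∨ P v ⊆ P u) : IsFlagFace f s := by
  obtain ⟨σ, hσ⟩ := exists_perm_of_chain s P hP hc
  refine ⟨x, σ, fun v hvs => ?_⟩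
  obtain ⟨j, hj⟩ := hσ v hvs
  exact ⟨j, by rw [hv v hvs]; congr 1; rw [hj, Finset.sum_map]; rfl⟩

theorem IsFlagFace.exists_sub_eq {f : Fin k → G} (hf : ∑ i, f i = 0) {s : Finset G}
    (h : IsFlagFace f s) {u v : G} (hu : u ∈ s) (hv : v ∈ s) :
    ∃ I : Finset (Fin k), I ≠ Finset.univ ∧ v - u = ∑ i ∈ I, f i := by
  obtain ⟨x, σ, h⟩ := h
  obtain ⟨a, ha⟩ := h u hu
  obtain ⟨b, hb⟩ := h v hv
  have hab : (Finset.Iio a).map σ.toEmbedding ⊆ (Finset.Iio b).map σ.toEmbedding ∨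
      (Finset.Iio b).map σ.toEmbedding ⊆ (Finset.Iio a).map σ.toEmbedding :=
    (le_total a b).imp
      (fun h => Finset.map_subset_map.2 (Finset.Iio_subset_Iio h))
      (fun h => Finset.map_subset_map.2 (Finset.Iio_subset_Iio h))
  refine ⟨typeBetween ((Finset.Iio a).map σ.toEmbedding) ((Finset.Iio b).map σ.toEmbedding),
    ?_, ?_⟩
  · intro h
    unfold typeBetween at h
    split_ifs at h with h1
    · have := Finset.mem_univ (σ b)
      rw [← h] at this
      simp at this
    · rw [Finset.compl_eq_univ_iff, Finset.sdiff_eq_empty_iff_subset] at h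
      exact h1 h
  · rw [sum_typeBetween f hf hab, Finset.sum_map, Finset.sum_map, ha, hb]
    simp

theorem IsFlagFace.image [DecidableEq H] {f : Fin k → G} {s : Finset G} (h : IsFlagFace f s)
    (φ : G →+ H) : IsFlagFace (fun i => φ (f i)) (s.image φ) := by
  obtain ⟨x, σ, h⟩ := h
  refine ⟨φ x, σ, fun v hv => ?_⟩
  obtain ⟨u, hu, rfl⟩ := Finset.mem_image.1 hv
  obtain ⟨j, rfl⟩ := h u hu
  exact ⟨j, by simp⟩

/-- Lift the base point arbitrarily, run through the same permutation upstairs, and keep the partial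
sums that lie over `t`. -/
theorem IsFlagFace.exists_lift [DecidableEq H] {f : Fin k → G} (φ : G →+ H)
    (hφ : Function.Surjective φ) {t : Finset H} (h : IsFlagFace (fun i => φ (f i)) t) :
    ∃ s : Finset G, IsFlagFace f s ∧ s.image φ = t := by
  classical
  obtain ⟨x, σ, h⟩ := h
  obtain ⟨y, rfl⟩ := hφ x
  refine ⟨(Finset.univ.image fun j : Fin k => y + ∑ i ∈ Finset.Iio j, f (σ i)).filter
    (φ · ∈ t), ⟨y, σ, fun v hv => ?_⟩, ?_⟩
  · simp only [Finset.mem_filter, Finset.mem_image, Finset.mem_univ, true_and] at hv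
    obtain ⟨⟨j, hj⟩, -⟩ := hv
    exact ⟨j, hj.symm⟩
  · ext v
    simp only [Finset.mem_image, Finset.mem_filter, Finset.mem_univ, true_and]
    constructor
    · rintro ⟨_, ⟨-, h1⟩, rfl⟩
      exact h1
    · intro hv
      obtain ⟨j, rfl⟩ := h v hv
      exact ⟨_, ⟨⟨j, rfl⟩, by simpa using hv⟩, by simp⟩

theorem mem_tonnetz_iff {n : ℕ} {L : Fin k → ℕ} {s : Finset (ZMod n)} :
    s ∈ (tonnetz n L).faces ↔ s.Nonempty ∧ IsFlagFace (fun i => (L i : ZMod n)) s := by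
  simp only [tonnetz, IsFlagFace, maxSimplex, Finset.subset_iff, Finset.mem_image,
    Finset.mem_univ, true_and, Set.mem_ofPred_eq, eq_comm]

end Flags

/-! ### The vectors `a_i` as generators of the permutohedral lattice -/

section Steps

variable {k : ℕ}

variable (k) in
/-- The homomorphism `p ↦ ∑ p_i a_i` from `ℤ^k` to the permutohedral lattice. -/
def stepHom : (Fin k → ℤ) →+ permLattice k where
  toFun p := ∑ i, p i • stepVector i
  map_zero' := by simp
  map_add' p q := by simp [add_smul, Finset.sum_add_distrib]

theorem stepHom_apply (p : Fin k → ℤ) : stepHom k p = ∑ i, p i • stepVector i := rfl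

theorem stepVector_apply (i j : Fin k) :
    (stepVector i : Fin k → ℤ) j = (if i = j then (k : ℤ) else 0) - 1 := by
  simp only [stepVector, eq_comm (a := i)]
  split_ifs <;> simp

theorem sum_stepVector_apply (I : Finset (Fin k)) (j : Fin k) :
    ((∑ i ∈ I, stepVector i : permLattice k) : Fin k → ℤ) j =
      (k : ℤ) * (if j ∈ I then 1 else 0) - I.card := by
  rw [AddSubgroup.val_finsetSum, Finset.sum_apply]
  simp [stepVector_apply, Finset.sum_sub_distrib]

theorem stepHom_coe (p : Fin k → ℤ) (j : Fin k) :
    (stepHom k p : Fin k → ℤ) j = k * p j - ∑ i, p i := by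
  rw [stepHom_apply, AddSubgroup.val_finsetSum, Finset.sum_apply]
  simp [stepVector_apply, mul_sub, Finset.sum_sub_distrib, mul_comm]

theorem stepHom_indicator (I : Finset (Fin k)) :
    stepHom k (fun i => if i ∈ I then 1 else 0) = ∑ i ∈ I, stepVector i := by
  simp [stepHom_apply]

theorem stepHom_const (m : ℤ) : stepHom k (fun _ => m) = 0 := by
  ext j
  simp [stepHom_coe]

theorem sum_stepVector : ∑ i : Fin k, stepVector i = 0 := by
  simpa [stepHom_apply] using stepHom_const (k := k) 1

theorem eq_of_stepHom_eq_zero {p : Fin k → ℤ} (h : stepHom k p = 0) (i j : Fin k) :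
    p i = p j := by
  have hk : (k : ℤ) ≠ 0 := by
    have := i.pos
    omega
  have h' : ∀ a, (k : ℤ) * p a = ∑ b, p b := fun a => by
    have := stepHom_coe p a
    rw [h] at this
    simp only [ZeroMemClass.coe_zero, Pi.zero_apply] at this
    linarith
  exact mul_left_cancel₀ hk ((h' i).trans (h' j).symm)

theorem stepHom_surjective [NeZero k] : Function.Surjective (stepHom k) := by
  rintro ⟨x, hsum, hmod⟩
  have hk : (k : ℤ) ≠ 0 := by exact_mod_cast NeZero.ne k
  have h1 : ∀ i, ∃ q : ℤ, x i - x 0 = k * q := fun i => (hmod 0 i).dvd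
  choose q hq using h1
  refine ⟨q, ?_⟩
  -- The congruences fix `q` up to a constant; summing `x i - x 0 = k * q i` and using `∑ x i = 0`
  -- recovers `x 0`.
  have h2 : x 0 = -∑ i, q i := by
    have h3 : ∑ i, (x i - x 0) = k * ∑ i, q i := by
      rw [Finset.mul_sum]
      exact Finset.sum_congr rfl fun i _ => hq i
    rw [Finset.sum_sub_distrib, hsum] at h3
    simp only [Finset.sum_const, Finset.card_univ, Fintype.card_fin, nsmul_eq_mul] at h3
    apply mul_left_cancel₀ hk
    linarith
  ext j
  rw [stepHom_coe]
  change _ = x j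
  have := hq j
  linarith

theorem exists_stepHom_eq [NeZero k] (z : permLattice k) :
    ∃ q : Fin k → ℤ, stepHom k q = z ∧ (∀ i, 0 ≤ q i) ∧ ∃ i, q i = 0 := by
  obtain ⟨q, rfl⟩ := stepHom_surjective z
  obtain ⟨i, hi⟩ := Finite.exists_min q
  refine ⟨q - fun _ => q i, ?_, fun j => ?_, i, ?_⟩
  · rw [map_sub, stepHom_const, sub_zero]
  · simpa using hi j
  · simp

end Steps

/-! ### Simplices of the Delone complex are the flags of the `a_i` -/

section Delone

variable {k : ℕ}

/-- By `stepHom_coe` this expresses the inner product of `∑ p_i a_i` and `∑ q_i a_i` through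
coordinate differences, where signs can be read off pair by pair. -/
theorem two_mul_sum_mul {R : Type*} [CommRing R] (p q : Fin k → R) :
    2 * ∑ i, (k * p i - ∑ j, p j) * (k * q i - ∑ j, q j) =
      k * ∑ i, ∑ j, (p i - p j) * (q i - q j) := by
  have h1 : ∀ i, (k * p i - ∑ j, p j) * (k * q i - ∑ j, q j) =
      k ^ 2 * (p i * q i) - k * (∑ j, q j) * p i - k * (∑ j, p j) * q i +
        (∑ j, p j) * (∑ j, q j) := fun i => by ring
  have h2 : ∀ i j, (p i - p j) * (q i - q j) = p i * q i - p i * q j - p j * q i + p j * q j :=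
    fun i j => by ring
  simp only [h1, h2, Finset.sum_add_distrib, Finset.sum_sub_distrib, Finset.sum_const,
    Finset.card_univ, Fintype.card_fin, nsmul_eq_mul]
  simp only [← Finset.mul_sum, ← Finset.sum_mul]
  ring

theorem dist_toEuclidean_le_iff (c : EuclideanSpace ℝ (Fin k)) (y z : permLattice k) :
    dist c (toEuclidean y) ≤ dist c (toEuclidean z) ↔
      ∑ i, (c i - ((y : Fin k → ℤ) i : ℝ)) ^ 2 ≤ ∑ i, (c i - ((z : Fin k → ℤ) i : ℝ)) ^ 2 := by
  rw [EuclideanSpace.dist_eq, EuclideanSpace.dist_eq, Real.sqrt_le_sqrt_iff (by positivity)]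
  simp [toEuclidean, Real.dist_eq, sq_abs]

/-- The difference of two lattice points nearest to the same centre is a sum of different
`a_i`. -/
theorem exists_sub_eq_of_nearest [NeZero k] {c : EuclideanSpace ℝ (Fin k)} {z w : permLattice k}
    (hz : ∀ y, dist c (toEuclidean z) ≤ dist c (toEuclidean y))
    (hw : ∀ y, dist c (toEuclidean w) ≤ dist c (toEuclidean y)) :
    ∃ I : Finset (Fin k), I ≠ Finset.univ ∧ w - z = ∑ i ∈ I, stepVector i := by
  classical
  obtain ⟨q, hq, hq0, i₀, hi₀⟩ := exists_stepHom_eq (w - z)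
  -- Truncate `q` at `1`. If `q ≠ p`, then `z + stepHom k p` and `z + stepHom k (q - p)` have a
  -- smaller total squared distance from `c` than `z` and `w`.
  let p : Fin k → ℤ := fun i => if 0 < q i then 1 else 0
  have hp : ∀ i, (q i = 0 ∧ p i = 0) ∨ (0 < q i ∧ p i = 1) := fun i => by
    rcases (hq0 i).eq_or_lt with h | h
    · exact Or.inl ⟨h.symm, by simp [p, ← h]⟩
    · exact Or.inr ⟨h, by simp [p, h]⟩
  have hnonneg : ∀ i j, 0 ≤ (p i - p j) * ((q - p) i - (q - p) j) := fun i j => by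
    simp only [Pi.sub_apply]
    rcases hp i with ⟨h1, h2⟩ | ⟨h1, h2⟩ <;> rcases hp j with ⟨h3, h4⟩ | ⟨h3, h4⟩ <;>
      rw [h2, h4] <;> omega
  -- With `a`, `b` the images of `p`, `q - p` and `d = c - z`, so that `w = z + a + b`, minimality
  -- gives `|d|² + |d - a - b|² ≤ |d - a|² + |d - b|²`, that is `⟨a, b⟩ ≤ 0`.
  have hle : ∑ i, (stepHom k p : Fin k → ℤ) i * (stepHom k (q - p) : Fin k → ℤ) i ≤ 0 := by
    have h1 := (dist_toEuclidean_le_iff _ _ _).1 (hz (z + stepHom k p))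
    have h2 := (dist_toEuclidean_le_iff _ _ _).1 (hw (z + stepHom k (q - p)))
    have hwz : w = z + stepHom k p + stepHom k (q - p) := by
      rw [add_assoc, ← map_add, add_sub_cancel, hq, add_sub_cancel]
    have h3 := add_le_add h1 h2
    rw [← sub_nonneg, hwz] at h3
    simp only [← Finset.sum_add_distrib, ← Finset.sum_sub_distrib, AddSubgroup.coe_add,
      Pi.add_apply, Int.cast_add] at h3
    have h4 : (0 : ℝ) ≤ ∑ i, (-2) * (((stepHom k p : Fin k → ℤ) i : ℝ) *
        ((stepHom k (q - p) : Fin k → ℤ) i : ℝ)) := by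
      refine h3.trans_eq (Finset.sum_congr rfl fun i _ => ?_)
      ring
    rw [← Finset.mul_sum] at h4
    have h5 : ∑ i, (((stepHom k p : Fin k → ℤ) i : ℝ) *
        ((stepHom k (q - p) : Fin k → ℤ) i : ℝ)) ≤ 0 := by linarith
    exact_mod_cast h5
  have hzero : ∑ i, ∑ j, (p i - p j) * ((q - p) i - (q - p) j) ≤ 0 := by
    have hk : (0 : ℤ) < k := by exact_mod_cast Nat.pos_of_ne_zero (NeZero.ne k)
    have h := two_mul_sum_mul p (q - p)
    simp only [stepHom_coe] at hle
    by_contra hlt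
    have := mul_pos hk (not_le.1 hlt)
    linarith
  -- The double sum has non-negative terms, and an index with `q i > 1` would make the term at `(i,
  -- i₀)` positive.
  have hq1 : ∀ i, q i = p i := fun i => by
    by_contra hne
    have h1 : p i = 1 ∧ 1 < q i := by
      rcases hp i with h | h <;> omega
    have h2 : p i₀ = 0 := by
      rcases hp i₀ with h | h <;> omega
    have h3 : 0 < (p i - p i₀) * ((q - p) i - (q - p) i₀) := by
      simp only [Pi.sub_apply, h1.1, h2, hi₀]
      omega
    refine absurd hzero (not_le.2 (h3.trans_le ?_))
    refine le_trans ?_ (Finset.single_le_sum (fun a _ => Finset.sum_nonneg fun b _ => hnonneg a b)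
      (Finset.mem_univ i))
    exact Finset.single_le_sum (f := fun b => (p i - p b) * ((q - p) i - (q - p) b))
      (fun b _ => hnonneg i b) (Finset.mem_univ i₀)
  refine ⟨Finset.univ.filter fun i => 0 < q i, fun h => ?_, ?_⟩
  · have := Finset.mem_univ i₀
    rw [← h] at this
    simp [hi₀] at this
  · rw [← hq, ← stepHom_indicator]
    congr 1
    ext i
    rw [hq1 i]
    simp [p]

theorem isFlagFace_of_mem_delone [NeZero k] {s : Finset (permLattice k)}
    (hs : s ∈ (deloneComplex k).faces) : IsFlagFace stepVector s := by
  obtain ⟨⟨z₀, hz₀⟩, c, -, hc⟩ := hs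
  have hT : ∀ z ∈ s, ∀ w ∈ s, ∃ I : Finset (Fin k), I ≠ Finset.univ ∧
      w - z = ∑ i ∈ I, stepVector i :=
    fun z hz w hw => exists_sub_eq_of_nearest (hc z hz) (hc w hw)
  choose! P hP using hT z₀ hz₀
  refine isFlagFace_of_chain z₀ P (fun v hv => (hP v hv).1)
    (fun v hv => by rw [← (hP v hv).2]; abel) fun u hu v hv => ?_
  obtain ⟨I, -, hI⟩ := hT u hu v hv
  by_contra hcon
  simp only [not_or, Finset.not_subset] at hcon
  obtain ⟨⟨i, hi, hi'⟩, j, hj, hj'⟩ := hcon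
  -- The indicator combination lies in the kernel and so is constant, but it is negative at `i` and
  -- non-negative at `j`.
  have h0 : stepHom k ((fun i => if i ∈ P v then 1 else 0) - (fun i => if i ∈ P u then 1 else 0) -
      fun i => if i ∈ I then 1 else 0) = 0 := by
    rw [map_sub, map_sub, stepHom_indicator, stepHom_indicator, stepHom_indicator, ← hI,
      ← (hP v hv).2, ← (hP u hu).2]
    abel
  have h1 := eq_of_stepHom_eq_zero h0 i j
  simp only [Pi.sub_apply, hi, hi', hj, hj', if_true, if_false] at h1
  split_ifs at h1 <;> omega

/-- For the centre `c_i = ½ ∑_j ε_ij` the squared distance splits into independent contributions `d²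
- ε_ij d` of the differences `d = p_i - p_j`. This allows minimization pair by pair. -/
theorem sum_sq_sub_stepHom (ε : Fin k → Fin k → ℤ) (hε : ∀ i j, ε j i = -ε i j)
    (p : Fin k → ℤ) :
    ∑ i, ((∑ j, (ε i j : ℝ)) / 2 - ((stepHom k p : Fin k → ℤ) i : ℝ)) ^ 2 =
      ∑ i, ((∑ j, (ε i j : ℝ)) / 2) ^ 2 +
        k / 2 * ∑ i, ∑ j, (((p i - p j) ^ 2 - ε i j * (p i - p j) : ℤ) : ℝ) := by
  have hanti : ∑ i, ∑ j, (ε i j : ℝ) * p j = -∑ i, ∑ j, (ε i j : ℝ) * p i := by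
    rw [Finset.sum_comm, ← Finset.sum_neg_distrib]
    refine Finset.sum_congr rfl fun i _ => ?_
    rw [← Finset.sum_neg_distrib]
    refine Finset.sum_congr rfl fun j _ => ?_
    rw [hε i j]
    push_cast
    ring
  have hzero : ∑ i, ∑ j, (ε i j : ℝ) = 0 := by
    have h : ∑ i, ∑ j, (ε i j : ℝ) = -∑ i, ∑ j, (ε i j : ℝ) := by
      conv_lhs => rw [Finset.sum_comm]
      rw [← Finset.sum_neg_distrib]
      refine Finset.sum_congr rfl fun i _ => ?_
      rw [← Finset.sum_neg_distrib]
      refine Finset.sum_congr rfl fun j _ => ?_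
      rw [hε i j]
      push_cast
      ring
    linarith
  have hsq := two_mul_sum_mul (fun i => (p i : ℝ)) (fun i => (p i : ℝ))
  have h1 : ∀ i, ((∑ j, (ε i j : ℝ)) / 2 - ((stepHom k p : Fin k → ℤ) i : ℝ)) ^ 2 =
      ((∑ j, (ε i j : ℝ)) / 2) ^ 2 - k * ((∑ j, (ε i j : ℝ)) * p i) +
        (∑ j, (p j : ℝ)) * (∑ j, (ε i j : ℝ)) +
        (k * (p i : ℝ) - ∑ j, (p j : ℝ)) * (k * (p i : ℝ) - ∑ j, (p j : ℝ)) := fun i => by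
    rw [stepHom_coe]
    push_cast
    ring
  have h2 : ∑ i, ∑ j, (((p i - p j) ^ 2 - ε i j * (p i - p j) : ℤ) : ℝ) =
      ∑ i, ∑ j, ((p i : ℝ) - p j) * ((p i : ℝ) - p j) - ∑ i, ∑ j, (ε i j : ℝ) * p i +
        ∑ i, ∑ j, (ε i j : ℝ) * p j := by
    simp only [← Finset.sum_sub_distrib, ← Finset.sum_add_distrib]
    refine Finset.sum_congr rfl fun i _ => Finset.sum_congr rfl fun j _ => ?_
    push_cast
    ring
  rw [h2, hanti]
  simp only [h1, Finset.sum_add_distrib, Finset.sum_sub_distrib, ← Finset.mul_sum, hzero,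
    mul_zero]
  simp only [Finset.sum_mul]
  linear_combination hsq / 2

theorem IsFlagFace.mem_delone [NeZero k] {s : Finset (permLattice k)} (hs : s.Nonempty)
    (h : IsFlagFace stepVector s) : s ∈ (deloneComplex k).faces := by
  obtain ⟨x, σ, h⟩ := h
  -- `ε i j` is `1` if `i` precedes `j` in the order given by `σ`, and `-1` if it follows. A partial
  -- sum along `σ` has differences `p_i - p_j ∈ {0, ε_ij}`, exactly where the integer function `d² -
  -- ε_ij d` takes its minimum `0`.
  let ε : Fin k → Fin k → ℤ := fun i j =>
    (if σ.symm i < σ.symm j then 1 else 0) - (if σ.symm j < σ.symm i then 1 else 0)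
  have hε : ∀ i j, ε j i = -ε i j := fun i j => by simp [ε]
  let c : Fin k → ℝ := fun i => (∑ j, (ε i j : ℝ)) / 2
  have hc : ∑ i, c i = 0 := by
    have h0 : ∑ i, ∑ j, (ε i j : ℝ) = -∑ i, ∑ j, (ε i j : ℝ) := by
      conv_lhs => rw [Finset.sum_comm]
      simp only [← Finset.sum_neg_distrib]
      exact Finset.sum_congr rfl fun i _ => Finset.sum_congr rfl fun j _ => by simp [hε i j]
    simp only [c, ← Finset.sum_div]
    linarith
  refine ⟨hs, WithLp.toLp 2 fun i => c i + ((x : Fin k → ℤ) i : ℝ), ?_, fun z hz y => ?_⟩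
  · have hx : ∑ i, ((x : Fin k → ℤ) i : ℝ) = 0 := by exact_mod_cast x.2.1
    simp [Finset.sum_add_distrib, hc, hx]
  have key : ∀ p : Fin k → ℤ, ∑ i, ((WithLp.toLp 2 fun i => c i + ((x : Fin k → ℤ) i : ℝ) :
      EuclideanSpace ℝ (Fin k)) i - (((x + stepHom k p : permLattice k) : Fin k → ℤ) i : ℝ)) ^ 2 =
      ∑ i, (c i) ^ 2 +
        k / 2 * ∑ i, ∑ j, (((p i - p j) ^ 2 - ε i j * (p i - p j) : ℤ) : ℝ) := fun p => by
    rw [← sum_sq_sub_stepHom ε hε p]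
    refine Finset.sum_congr rfl fun i _ => ?_
    simp only [c, AddSubgroup.coe_add, Pi.add_apply, Int.cast_add]
    ring
  rw [dist_toEuclidean_le_iff]
  obtain ⟨j, rfl⟩ := h z hz
  obtain ⟨q, hq⟩ := stepHom_surjective (y - x)
  obtain rfl : y = x + stepHom k q := by rw [hq]; abel
  have hj : ∑ i ∈ Finset.Iio j, stepVector (σ i) =
      stepHom k (fun i => if σ.symm i < j then 1 else 0) := by
    have := stepHom_indicator ((Finset.Iio j).map σ.toEmbedding)
    rw [Finset.sum_map] at this
    simpa [Finset.mem_map_equiv] using this.symm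
  rw [hj, key, key]
  refine add_le_add_right (mul_le_mul_of_nonneg_left (Finset.sum_le_sum fun a _ =>
    Finset.sum_le_sum fun b _ => Int.cast_le.2 ?_) (by positivity)) _
  have h1 : ((if σ.symm a < j then 1 else 0) - (if σ.symm b < j then 1 else 0) : ℤ) ^ 2 -
      ε a b * ((if σ.symm a < j then 1 else 0) - (if σ.symm b < j then 1 else 0)) = 0 := by
    simp only [ε]
    split_ifs <;> first | rfl | (exfalso; omega)
  have h2 : 0 ≤ (q a - q b) ^ 2 - ε a b * (q a - q b) := by
    have hεab : ε a b = 1 ∨ ε a b = 0 ∨ ε a b = -1 := by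
      simp only [ε]
      split_ifs <;> simp
    rcases hεab with h | h | h <;> rw [h]
    · rcases le_or_gt (q a - q b) 0 with h' | h' <;> nlinarith
    · nlinarith
    · rcases le_or_gt 0 (q a - q b) with h' | h' <;> nlinarith
  rw [h1]
  exact h2

theorem mem_delone_iff [NeZero k] {s : Finset (permLattice k)} :
    s ∈ (deloneComplex k).faces ↔ s.Nonempty ∧ IsFlagFace stepVector s :=
  ⟨fun h => ⟨h.1, isFlagFace_of_mem_delone h⟩, fun h => h.2.mem_delone h.1⟩

end Delone

/-! ### The length homomorphism and its kernel -/

section Periods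

variable {n k : ℕ} {L : Fin k → ℕ}

theorem IsReduced.neZero (hr : IsReduced L) : NeZero k :=
  ⟨by rintro rfl; simp [IsReduced] at hr⟩

theorem IsLengthVector.sum_lt (hL : IsLengthVector n L) {I : Finset (Fin k)}
    (hI : I ≠ Finset.univ) : ∑ i ∈ I, L i < n := by
  obtain ⟨j, hj⟩ : ∃ j, j ∉ I := by
    by_contra! h
    exact hI (Finset.eq_univ_iff_forall.2 h)
  rw [← hL.sum_eq]
  exact Finset.sum_lt_sum_of_subset (Finset.subset_univ I) (Finset.mem_univ j) hj (hL.pos j)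
    fun _ _ _ => Nat.zero_le _

/-- Sums over proper index sets are less than `n`, so a congruence between them is an equality, and
genericity applies. -/
theorem eq_of_sum_cast_eq (hL : IsLengthVector n L) (hg : IsGeneric L) {I J : Finset (Fin k)}
    (hI : I ≠ Finset.univ) (hJ : J ≠ Finset.univ)
    (h : ∑ i ∈ I, (L i : ZMod n) = ∑ i ∈ J, (L i : ZMod n)) : I = J := by
  rw [← Nat.cast_sum, ← Nat.cast_sum, ZMod.natCast_eq_natCast_iff',
    Nat.mod_eq_of_lt (hL.sum_lt hI), Nat.mod_eq_of_lt (hL.sum_lt hJ)] at h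
  exact hg I J h

theorem exists_sum_mul_eq_one (hr : IsReduced L) : ∃ p : Fin k → ℤ, ∑ i, p i * (L i : ℤ) = 1 := by
  let f : (Fin k → ℤ) →+ ℤ :=
    { toFun := fun p => ∑ i, p i * (L i : ℤ)
      map_zero' := by simp
      map_add' := fun p q => by simp [add_mul, Finset.sum_add_distrib] }
  obtain ⟨d, hd⟩ := Int.subgroup_cyclic f.range
  have hdvd : d.natAbs ∣ 1 := by
    rw [← show Finset.univ.gcd L = 1 from hr]
    refine Finset.dvd_gcd fun i _ => ?_
    have h : (L i : ℤ) ∈ f.range := ⟨Pi.single i 1, by simp [f, Pi.single_apply]⟩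
    rw [hd, AddSubgroup.mem_closure_singleton] at h
    obtain ⟨m, hm⟩ := h
    rw [← Int.natCast_dvd_natCast, Int.natAbs_dvd, ← hm]
    simp
  have h1 : (1 : ℤ) ∈ f.range := by
    rw [hd, AddSubgroup.mem_closure_singleton]
    rcases Int.natAbs_eq d with h | h <;> rw [Nat.dvd_one.1 hdvd] at h
    · exact ⟨1, by simp [h]⟩
    · exact ⟨-1, by simp [h]⟩
  exact h1

/-- There is a homomorphism from the permutohedral lattice to `ℤ/n` that sends `a_i` to `l_i`. -/
theorem exists_lengthHom [NeZero k] (hL : IsLengthVector n L) :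
    ∃ φ : permLattice k →+ ZMod n, ∀ i, φ (stepVector i) = L i := by
  let f : (Fin k → ℤ) →+ ZMod n :=
    { toFun := fun p => ∑ i, (p i : ZMod n) * (L i : ZMod n)
      map_zero' := by simp
      map_add' := fun p q => by simp [add_mul, Finset.sum_add_distrib] }
  -- Kernel elements are constant vectors, and `f` sends these to multiples of `∑ l_i = 0`.
  have hf : (stepHom k).ker ≤ f.ker := fun p hp => by
    have h : ∀ i, p i = p 0 := fun i => eq_of_stepHom_eq_zero hp i 0
    change ∑ i, (p i : ZMod n) * (L i : ZMod n) = 0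
    rw [Finset.sum_congr rfl fun i _ => by rw [h i], ← Finset.mul_sum, hL.sum_cast, mul_zero]
  refine ⟨(stepHom k).liftOfSurjective stepHom_surjective ⟨f, hf⟩, fun i => ?_⟩
  have h : stepVector i = stepHom k (Pi.single i 1) := by
    simp [stepHom_apply, Pi.single_apply]
  rw [h]
  refine (AddMonoidHom.liftOfRightInverse_comp_apply _ _ _ _ _).trans ?_
  simp [f, Pi.single_apply]

variable {φ : permLattice k →+ ZMod n}

theorem apply_stepHom (hφ : ∀ i, φ (stepVector i) = L i) (p : Fin k → ℤ) :
    φ (stepHom k p) = ((∑ i, p i * (L i : ℤ) : ℤ) : ZMod n) := by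
  simp [stepHom_apply, hφ]

theorem lengthHom_surjective (hr : IsReduced L) (hφ : ∀ i, φ (stepVector i) = L i) :
    Function.Surjective φ := fun x => by
  obtain ⟨p, hp⟩ := exists_sum_mul_eq_one hr
  obtain ⟨m, rfl⟩ := ZMod.intCast_surjective x
  exact ⟨m • stepHom k p, by rw [map_zsmul, apply_stepHom hφ, hp]; simp⟩

theorem coe_ker_lengthHom [NeZero k] (hφ : ∀ i, φ (stepVector i) = L i) :
    (φ.ker : Set (permLattice k)) =
      {z | ∃ p : Fin k → ℤ, (∃ p₀ : ℤ, ∑ i, p i * (L i : ℤ) = p₀ * (n : ℤ)) ∧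
        z = ∑ i, p i • stepVector i} := by
  have h : ∀ p : Fin k → ℤ, φ (stepHom k p) = 0 ↔
      ∃ p₀ : ℤ, ∑ i, p i * (L i : ℤ) = p₀ * (n : ℤ) := fun p => by
    rw [apply_stepHom hφ, ZMod.intCast_zmod_eq_zero_iff_dvd, dvd_iff_exists_eq_mul_left]
  ext z
  constructor
  · intro hz
    obtain ⟨p, rfl⟩ := stepHom_surjective z
    exact ⟨p, (h p).1 hz, rfl⟩
  · rintro ⟨p, hp, rfl⟩
    exact (h p).2 hp

/-! ### Values of `ω` on chains and the identity `Λ_L = ker φ` -/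

theorem omega_of (hL : IsLengthVector n L) (hg : IsGeneric L) (e : OrientedEdge (tonnetz n L)) :
    omega hL hg (Chain₁.of e) = ∑ i ∈ edgeType hL e, stepVector i := by
  ext j
  rw [sum_stepVector_apply]
  exact omegaCoord_of hL hg j e

theorem lengthHom_omega_of (hL : IsLengthVector n L) (hg : IsGeneric L)
    (hφ : ∀ i, φ (stepVector i) = L i) (e : OrientedEdge (tonnetz n L)) :
    φ (omega hL hg (Chain₁.of e)) = e.tgt - e.src := by
  rw [omega_of, map_sum, (exists_edgeType hL e).choose_spec.2]
  exact Finset.sum_congr rfl fun i _ => hφ i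

theorem boundary₁_of {V : Type*} [DecidableEq V] {K : PreAbstractSimplicialComplex V}
    (e : OrientedEdge K) :
    boundary₁ K (Chain₁.of e) = Finsupp.single e.tgt 1 - Finsupp.single e.src 1 :=
  Chain₁.lift_of _ _ e

/-- Both sides are additive and agree on edges. In particular `φ ∘ ω` vanishes on cycles. -/
theorem lengthHom_omega (hL : IsLengthVector n L) (hg : IsGeneric L)
    (hφ : ∀ i, φ (stepVector i) = L i) (c : Chain₁ (tonnetz n L)) :
    φ (omega hL hg c) =
      Finsupp.liftAddHom (fun v : ZMod n => zmultiplesHom (ZMod n) v)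
        (boundary₁ (tonnetz n L) c) := by
  induction c using Chain₁.induction with
  | h0 => simp
  | hadd a b ha hb => simp only [map_add, ha, hb]
  | hneg a ha => simp only [map_neg, ha]
  | hof e =>
    rw [lengthHom_omega_of hL hg hφ, boundary₁_of, map_sub]
    simp

theorem isEdge_add (hL : IsLengthVector n L) (hk : 2 ≤ k) (x : ZMod n) (i : Fin k) :
    IsEdge (tonnetz n L) x (x + (L i : ZMod n)) := by
  have hi : ({i} : Finset (Fin k)) ≠ Finset.univ := fun h => by
    have := congrArg Finset.card h
    simp at this
    omega
  constructor
  · intro h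
    have h1 : (L i : ZMod n) = 0 := by simpa using h
    rw [ZMod.natCast_eq_zero_iff] at h1
    have h2 := hL.sum_lt hi
    rw [Finset.sum_singleton] at h2
    exact absurd (Nat.le_of_dvd (hL.pos i) h1) (not_le.2 h2)
  · rw [mem_tonnetz_iff]
    refine ⟨by simp, ?_⟩
    have h0 : ∃ P : ZMod n → Finset (Fin k), P x = ∅ ∧ ∀ y ≠ x, P y = {i} := by
      classical
      exact ⟨fun y => if y = x then ∅ else {i}, by simp, fun y hy => by simp [hy]⟩
    obtain ⟨P, hPx, hP⟩ := h0
    have hP' : ∀ y, (y = x ∧ P y = ∅) ∨ P y = {i} := fun y => by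
      by_cases hy : y = x
      · exact Or.inl ⟨hy, by rw [hy, hPx]⟩
      · exact Or.inr (hP y hy)
    refine isFlagFace_of_chain x P (fun v _ => ?_) (fun v hv => ?_) fun u _ v _ => ?_
    · rcases hP' v with ⟨-, h⟩ | h <;> rw [h]
      · exact fun h' => absurd (Finset.mem_univ i) (by simp [← h'])
      · exact hi
    · by_cases hvx : v = x
      · rw [hvx, hPx]; simp
      · rw [hP v hvx, Finset.sum_singleton]
        simpa [hvx] using hv
    · rcases hP' u with ⟨-, h⟩ | h <;> rcases hP' v with ⟨-, h'⟩ | h' <;> rw [h, h'] <;> simp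

theorem omega_of_step (hL : IsLengthVector n L) (hg : IsGeneric L) (x : ZMod n) (i : Fin k)
    (h : IsEdge (tonnetz n L) x (x + (L i : ZMod n))) :
    omega hL hg (Chain₁.of (OrientedEdge.mk x (x + (L i : ZMod n)) h)) = stepVector i := by
  rw [omega_of, edgeType_eq hL hg _ {i} (by simp [OrientedEdge.mk, OrientedEdge.src,
    OrientedEdge.tgt]), Finset.sum_singleton]

/-- Every lattice vector is the value of `ω` on a path from a given vertex. -/
theorem exists_chain [NeZero k] (hL : IsLengthVector n L) (hg : IsGeneric L)
    (hφ : ∀ i, φ (stepVector i) = L i) (z : permLattice k) (x : ZMod n) :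
    ∃ c : Chain₁ (tonnetz n L),
      boundary₁ (tonnetz n L) c = Finsupp.single (x + φ z) 1 - Finsupp.single x 1 ∧
      omega hL hg c = z := by
  -- All starting points are allowed at once: a sum needs its second path to start where the first
  -- ends, and a negative reverses a path that starts at `x - φ a`.
  let S : AddSubgroup (permLattice k) :=
    { carrier := {z | ∀ x : ZMod n, ∃ c : Chain₁ (tonnetz n L),
        boundary₁ (tonnetz n L) c = Finsupp.single (x + φ z) 1 - Finsupp.single x 1 ∧
        omega hL hg c = z}
      zero_mem' := fun x => ⟨0, by simp⟩
      add_mem' := fun {a b} ha hb x => by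
        obtain ⟨c, hc, rfl⟩ := ha x
        obtain ⟨d, hd, rfl⟩ := hb (x + φ (omega hL hg c))
        refine ⟨c + d, ?_, map_add _ _ _⟩
        rw [map_add, hc, hd, map_add, add_assoc]
        abel
      neg_mem' := fun {a} ha x => by
        obtain ⟨c, hc, hca⟩ := ha (x - φ a)
        refine ⟨-c, ?_, by rw [map_neg, hca]⟩
        rw [map_neg, hc, map_neg, sub_add_cancel, neg_sub, sub_eq_add_neg x] }
  have hstep : ∀ i, stepVector i ∈ S := fun i x => by
    rcases le_or_gt 2 k with hk | hk
    · refine ⟨Chain₁.of (.mk _ _ (isEdge_add hL hk x i)), ?_, omega_of_step hL hg x i _⟩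
      rw [boundary₁_of, hφ]
      rfl
    -- For `k = 1` there are no edges, but the only step vector is `0`, and the zero chain suffices.
    · obtain rfl : k = 1 := by have := NeZero.ne k; omega
      have h0 : stepVector i = 0 := by
        have := sum_stepVector (k := 1)
        rwa [Fin.sum_univ_one, ← Subsingleton.elim i 0] at this
      exact ⟨0, by simp [h0]⟩
  obtain ⟨p, rfl⟩ := stepHom_surjective z
  have hp : stepHom k p ∈ S := by
    rw [stepHom_apply]
    exact S.sum_mem fun i _ => S.zsmul_mem (hstep i) (p i)
  exact hp x

theorem periodLattice_eq_ker [NeZero k] (hL : IsLengthVector n L) (hg : IsGeneric L)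
    (hφ : ∀ i, φ (stepVector i) = L i) : periodLattice hL hg = φ.ker := by
  ext z
  constructor
  · rintro ⟨c, rfl⟩
    obtain ⟨⟨c, hc⟩, rfl⟩ := QuotientAddGroup.mk_surjective c
    change φ (omega hL hg c) = 0
    rw [lengthHom_omega hL hg hφ, show boundary₁ (tonnetz n L) c = 0 from hc, map_zero]
  · intro hz
    obtain ⟨c, hc, rfl⟩ := exists_chain hL hg hφ z 0
    rw [show φ _ = 0 from hz, add_zero, sub_self] at hc
    exact ⟨QuotientAddGroup.mk ⟨c, hc⟩, rfl⟩

/-! ### The quotient of the Delone complex by `ker φ` -/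

theorem mk_eq_mk_iff {A B : Type*} [AddCommGroup A] [AddCommGroup B] (φ : A →+ B) (u v : A) :
    (QuotientAddGroup.mk u : A ⧸ φ.ker) = QuotientAddGroup.mk v ↔ φ u = φ v := by
  rw [QuotientAddGroup.eq, AddMonoidHom.mem_ker, map_add, map_neg, neg_add_eq_zero]

theorem actsRegularly_ker [NeZero k] (hL : IsLengthVector n L) (hg : IsGeneric L)
    (hφ : ∀ i, φ (stepVector i) = L i) : ActsRegularly φ.ker := by
  have hlen : ∀ I : Finset (Fin k), φ (∑ i ∈ I, stepVector i) = ∑ i ∈ I, (L i : ZMod n) :=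
    fun I => by rw [map_sum]; exact Finset.sum_congr rfl fun i _ => hφ i
  -- Inside a simplex, a difference of vertices is a sum of `a_i` over a proper index set. By
  -- genericity its image under `φ` determines that set, hence the difference itself.
  have key : ∀ s ∈ (deloneComplex k).faces, ∀ t ∈ (deloneComplex k).faces,
      ∀ u ∈ s, ∀ v ∈ s, ∀ u' ∈ t, ∀ v' ∈ t, φ u = φ u' → φ v = φ v' → v - u = v' - u' := by
    intro s hs t ht u hu v hv u' hu' v' hv' h1 h2
    obtain ⟨I, hI, hIe⟩ := (isFlagFace_of_mem_delone hs).exists_sub_eq sum_stepVector hu hv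
    obtain ⟨J, hJ, hJe⟩ := (isFlagFace_of_mem_delone ht).exists_sub_eq sum_stepVector hu' hv'
    rw [hIe, hJe, eq_of_sum_cast_eq hL hg hI hJ]
    rw [← hlen, ← hlen, ← hIe, ← hJe, map_sub, map_sub, h1, h2]
  refine ⟨fun s hs u hu v hv h => ?_, fun s hs t ht h => ?_⟩
  · rw [mk_eq_mk_iff] at h
    have := key s hs s hs u hu v hv u hu u hu rfl h.symm
    rw [sub_self, sub_eq_zero] at this
    exact this.symm
  · obtain ⟨z₀, hz₀⟩ := hs.1
    have hst : ∀ z ∈ s, ∃ w ∈ t, φ z = φ w := fun z hz => by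
      obtain ⟨w, hw, hwz⟩ := h.subset (Set.mem_image_of_mem _ (Finset.mem_coe.2 hz))
      exact ⟨w, hw, ((mk_eq_mk_iff φ _ _).1 hwz).symm⟩
    have hts : ∀ w ∈ t, ∃ z ∈ s, φ z = φ w := fun w hw => by
      obtain ⟨z, hz, hwz⟩ := h.symm.subset (Set.mem_image_of_mem _ (Finset.mem_coe.2 hw))
      exact ⟨z, hz, (mk_eq_mk_iff φ _ _).1 hwz⟩
    obtain ⟨w₀, hw₀, h₀⟩ := hst z₀ hz₀
    refine ⟨w₀ - z₀, by rw [AddMonoidHom.mem_ker, map_sub, h₀, sub_self], ?_⟩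
    ext w
    simp only [Finset.mem_coe, Set.mem_image]
    constructor
    · intro hw
      obtain ⟨z, hz, hzw⟩ := hts w hw
      refine ⟨z, hz, ?_⟩
      have := key s hs t ht z₀ hz₀ z hz w₀ hw₀ w hw h₀ hzw
      rw [show w₀ - z₀ + z = z - z₀ + w₀ by abel, this, sub_add_cancel]
    · rintro ⟨z, hz, rfl⟩
      obtain ⟨w, hw, hzw⟩ := hst z hz
      have := key s hs t ht z₀ hz₀ z hz w₀ hw₀ w hw h₀ hzw
      have h3 : w₀ - z₀ + z = w := by
        rw [show w₀ - z₀ + z = z - z₀ + w₀ by abel, this, sub_add_cancel]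
      rwa [h3]

/-- Under `e`, the quotient map becomes `φ`, which maps flags of the `a_i` to flags of the `l_i`;
surjectivity lets every flag of the `l_i` be lifted. -/
theorem mem_deloneQuotient_ker_iff [NeZero k] (hφ : ∀ i, φ (stepVector i) = L i)
    (hsurj : Function.Surjective φ) (e : permLattice k ⧸ φ.ker ≃+ ZMod n)
    (he : ∀ z, e (QuotientAddGroup.mk z) = φ z) (t : Finset (ZMod n)) :
    t.map e.symm.toEquiv.toEmbedding ∈ (deloneQuotient φ.ker).faces ↔
      t ∈ (tonnetz n L).faces := by
  classical
  have hmk : ∀ z, QuotientAddGroup.mk z = e.symm (φ z) := fun z => by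
    rw [← he, AddEquiv.symm_apply_apply]
  have himg : ∀ s : Finset (permLattice k),
      s.image (QuotientAddGroup.mk : permLattice k → permLattice k ⧸ φ.ker) =
        (s.image φ).map e.symm.toEquiv.toEmbedding := fun s => by
    rw [Finset.map_eq_image, Finset.image_image]
    exact Finset.image_congr fun z _ => hmk z
  have hL' : (fun i => φ (stepVector i)) = fun i => (L i : ZMod n) := funext hφ
  rw [mem_tonnetz_iff, ← hL']
  constructor
  · rintro ⟨s, hs, hst⟩
    have hst' : s.image φ = t := by
      apply Finset.map_injective e.symm.toEquiv.toEmbedding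
      rw [← himg, ← hst]
      congr!
    rw [mem_delone_iff] at hs
    rw [← hst']
    exact ⟨hs.1.image _, hs.2.image φ⟩
  · rintro ⟨hne, ht⟩
    obtain ⟨s, hs, rfl⟩ := ht.exists_lift φ hsurj
    refine ⟨s, mem_delone_iff.2 ⟨Finset.image_nonempty.1 hne, hs⟩, ?_⟩
    rw [← himg]
    congr!

theorem tonnetz_translate (v : ZMod n) (s : Finset (ZMod n)) :
    s.map (Equiv.subRight v).toEmbedding ∈ (tonnetz n L).faces ↔ s ∈ (tonnetz n L).faces := by
  have h : ∀ (v : ZMod n) (s : Finset (ZMod n)), s ∈ (tonnetz n L).faces →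
      s.map (Equiv.subRight v).toEmbedding ∈ (tonnetz n L).faces := by
    intro v s hs
    rw [mem_tonnetz_iff] at hs ⊢
    obtain ⟨hne, x, σ, h⟩ := hs
    refine ⟨hne.map, x - v, σ, fun u hu => ?_⟩
    obtain ⟨w, hw, rfl⟩ := Finset.mem_map.1 hu
    obtain ⟨j, rfl⟩ := h w hw
    exact ⟨j, by simp [sub_add_eq_add_sub]⟩
  refine ⟨fun hs => ?_, h v s⟩
  have := h (-v) _ hs
  rw [Finset.map_map] at this
  convert this
  ext u
  simp

end Periods

end GenTonnetz

theorem mainTheorem10 {n k : ℕ} (L : Fin k → ℕ) (hL : GenTonnetz.IsLengthVector n L)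
    (hg : GenTonnetz.IsGeneric L) (hr : GenTonnetz.IsReduced L) :
    -- the vectors `a_i` are the values of `ω` on the steps `x → x + l_i`
    (2 ≤ k → ∀ (x : ZMod n) (i : Fin k),
      ∃ h : GenTonnetz.IsEdge (GenTonnetz.tonnetz n L) x (x + (L i : ZMod n)),
        GenTonnetz.omega hL hg
          (GenTonnetz.Chain₁.of (GenTonnetz.OrientedEdge.mk x (x + (L i : ZMod n)) h)) =
            GenTonnetz.stepVector i) ∧
    -- the explicit description of `Λ_L`
    (GenTonnetz.periodLattice hL hg : Set (GenTonnetz.permLattice k)) =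
      {z | ∃ p : Fin k → ℤ, (∃ p₀ : ℤ, ∑ i, p i * (L i : ℤ) = p₀ * (n : ℤ)) ∧
        z = ∑ i, p i • GenTonnetz.stepVector i} ∧
    -- `Λ_L` is the lattice in the isomorphism of the Tonnetz with `𝒟_Λ / Λ_L` induced by `ω`
    GenTonnetz.ActsRegularly (GenTonnetz.periodLattice hL hg) ∧
    ∀ v₀ : ZMod n,
      ∃ Φ : ZMod n ≃ GenTonnetz.permLattice k ⧸ GenTonnetz.periodLattice hL hg,
        GenTonnetz.IsSimplicialIso (GenTonnetz.tonnetz n L)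
          (GenTonnetz.deloneQuotient (GenTonnetz.periodLattice hL hg)) Φ ∧
        Φ v₀ = 0 ∧
        ∀ e : GenTonnetz.OrientedEdge (GenTonnetz.tonnetz n L),
          Φ e.tgt = Φ e.src +
            (QuotientAddGroup.mk (GenTonnetz.omega hL hg (GenTonnetz.Chain₁.of e)) :
              GenTonnetz.permLattice k ⧸ GenTonnetz.periodLattice hL hg) := by
  have : NeZero k := hr.neZero
  obtain ⟨φ, hφ⟩ := GenTonnetz.exists_lengthHom hL
  have hsurj := GenTonnetz.lengthHom_surjective hr hφ
  refine ⟨fun hk x i => ⟨GenTonnetz.isEdge_add hL hk x i, GenTonnetz.omega_of_step hL hg x i _⟩,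
    ?_⟩
  rw [GenTonnetz.periodLattice_eq_ker hL hg hφ]
  refine ⟨GenTonnetz.coe_ker_lengthHom hφ, GenTonnetz.actsRegularly_ker hL hg hφ, fun v₀ => ?_⟩
  let E := QuotientAddGroup.quotientKerEquivOfSurjective φ hsurj
  -- `Φ` sends `v` to the class of any `z` with `φ(z) = v - v₀`. The shift by `v₀` is an
  -- automorphism of the Tonnetz, and the edge relation reduces to `φ(ω(e)) = e.tgt - e.src`.
  refine ⟨(Equiv.subRight v₀).trans E.symm.toEquiv, fun s => ?_, ?_, fun e => ?_⟩
  · have h := GenTonnetz.mem_deloneQuotient_ker_iff hφ hsurj E (fun _ => rfl)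
      (s.map (Equiv.subRight v₀).toEmbedding)
    rw [Finset.map_map, GenTonnetz.tonnetz_translate] at h
    exact h.symm
  · change E.symm (v₀ - v₀) = 0
    rw [sub_self, map_zero]
  · change E.symm (e.tgt - v₀) = E.symm (e.src - v₀) + _
    apply E.injective
    rw [map_add, AddEquiv.apply_symm_apply, AddEquiv.apply_symm_apply]
    change _ = _ + φ _
    rw [GenTonnetz.lengthHom_omega_of hL hg hφ]
    abel
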